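/- **Notation.** Let $A$ be a set, $\widetilde A=A\cup A^{-1}$ with its involution $x\mapsto x^{-1}$, extended to $\widetilde A^*$ by $(x_1\cdots x_n)^{-1}=x_n^{-1}\cdots x_1^{-1}$. Let $\rho_A$ be the congruence on $\widetilde A^*$ generated by all pairs $(ww^{-1}w,w)$ and $(uu^{-1}vv^{-1},vv^{-1}uu^{-1})$. For $R\subseteq\widetilde A^*\times\widetilde A^*$ let $\tau=(\rho_A\cup R)^\sharp$ be the congruence generated by $\rho_A\cup R$; the inverse monoid $\mathrm{Inv}\langle A\mid R\rangle$ is $\widetilde A^*/\tau$. The *Schützenberger automaton* $\mathcal A(w)$ of $w\in\widetilde A^*$ with respect to $\mathrm{Inv}\langle A\mid R\rangle$ has as states the elements of the $\mathcal R$-class of $w\tau$, a transition $m\xrightarrow{x}n$ whenever $m,n$ are in this class, $x\in\widetilde A$ and $n=m\cdot x\tau$, initial state $(ww^{-1})\tau$ and terminal state $w\tau$. For an automaton $\mathcal B$, $\mathrm{Fold}(\mathcal B)$ is obtained by successively identifying states $q,q'$ whenever there are transitions $q\xleftarrow{x}p\xrightarrow{x}q'$ (that is, it is the quotient of $\mathcal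 B$ by the least equivalence relation $\sim$ such that $p\sim p'$, $p\xrightarrow{x}q$, $p'\xrightarrow{x}q'$ imply $q\sim q'$). For a relation $S\subseteq\widetilde A^*\times\widetilde A^*$, an *elementary expansion* of an $\widetilde A$-automaton $\mathcal B$ adds a new path $q_1\xrightarrow{u}q_2$ (together with the inverse path) to $\mathcal B$, where $q_1\xrightarrow{v}q_2$ is a path in $\mathcal B$ and $(u,v)\in S$ or $(v,u)\in S$; when $u$ is empty this identifies $q_1$ and $q_2$. The *(Stephen) closure* $\mathrm{Cl}_S(\mathcal B)$ is the colimit of the directed system of all automata obtained from $\mathcal B$ by finite sequences of elementary expansions and foldings of two edges. For $a\in A$ put $A_a=A\setminus\{a\}$, let $\theta_a:\widetilde A^*\to\widetilde{A_a}^*$ be the homomorphism that erases $a$ and $a^{-1}$ and fixes all other letters, and let $R\overline\theta_a=\{(u\theta_a,v\theta_a):(u,v)\in R\}$. The *$a$-contracted automaton* $\chi_a(\mathcal A)$ of an inverse $\widetilde A$-automaton $\mathcal A$ is $\mathrm{Fold}(\mathcal B)$, where $\mathcal B$ is the $\widetilde{A_a}$-automaton obtained from $\mathcal A$ by identifying all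 states $p,q$ such that $p\xrightarrow{a}q$ is a transition and erasing the resulting loops labelled $a$ and $a^{-1}$. **Proposition.** Let $\mathrm{Inv}\langle A\mid R\rangle$ be a presentation and $a\in A$. For every word $w\in\widetilde A^*$, let $\mathcal A(w)$ be the Schützenberger automaton of $w$ with respect to $\mathrm{Inv}\langle A\mid R\rangle$, and let $\mathcal A(w\theta_a)$ be the Schützenberger automaton of $w\theta_a$ with respect to $\mathrm{Inv}\langle A_a\mid R\overline\theta_a\rangle$. Then $$\mathcal A(w\theta_a)\;\cong\;\mathrm{Cl}_{R\overline\theta_a}\bigl(\chi_a(\mathcal A(w))\bigr),$$ where $\cong$ is isomorphism of automata (a bijection between the states that matches initial states, terminal states and transitions). -/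

import Mathlib

universe u v v'

namespace InvPres

/-! ## Words over `A ∪ A⁻¹` and presentations of inverse monoids -/

/-- The alphabet `A ∪ A⁻¹`: the pair `(a, true)` is the letter `a`, the pair `(a, false)` is the
formal inverse `a⁻¹`. -/
abbrev Letter (A : Type u) : Type u := A × Bool

/-- The involution `a ↔ a⁻¹` of `A ∪ A⁻¹`. -/
def Letter.inv {A : Type u} (x : Letter A) : Letter A := (x.1, !x.2)

/-- The free monoid on `A ∪ A⁻¹`. -/
abbrev Word (A : Type u) : Type u := FreeMonoid (Letter A)

/-- The involution of the free monoid on `A ∪ A⁻¹`: `(x₁ ⋯ xₙ)⁻¹ = xₙ⁻¹ ⋯ x₁⁻¹`. -/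
def Word.inv {A : Type u} (w : Word A) : Word A :=
  FreeMonoid.ofList (w.toList.map Letter.inv).reverse

/-- The pairs `(w w⁻¹ w, w)` and `(u u⁻¹ v v⁻¹, v v⁻¹ u u⁻¹)` generating the Vagner congruence. -/
inductive VagnerRel (A : Type u) : Word A → Word A → Prop
  | regular (w : Word A) : VagnerRel A (w * w.inv * w) w
  | commute (u v : Word A) :
      VagnerRel A (u * u.inv * (v * v.inv)) (v * v.inv * (u * u.inv))

/-- The Vagner congruence `ρ_A`, so that the quotient is the free inverse monoid on `A`. -/
def vagnerCon (A : Type u) : Con (Word A) := conGen (VagnerRel A)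

/-- The congruence `τ` generated by `ρ_A ∪ R`. -/
def presCon {A : Type u} (R : Set (Word A × Word A)) : Con (Word A) :=
  conGen (fun x y => vagnerCon A x y ∨ (x, y) ∈ R)

/-- The inverse monoid presented by `Inv⟨A | R⟩`. -/
abbrev PresMonoid {A : Type u} (R : Set (Word A × Word A)) : Type u := (presCon R).Quotient

/-- The class of a word in the monoid presented by `Inv⟨A | R⟩`. -/
def cls {A : Type u} (R : Set (Word A × Word A)) (w : Word A) : PresMonoid R :=
  (w : (presCon R).Quotient)

/-- Green's relation `𝓡`. -/
def GreenR {M : Type u} [Monoid M] (m n : M) : Prop :=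
  (∃ x, m = n * x) ∧ ∃ y, n = m * y

/-! ## Automata -/

/-- An automaton over the alphabet `X` with one initial and one terminal state; `edge p x q` means
that there is a transition from `p` to `q` labelled `x`. -/
structure Automaton (X : Type u) : Type (max u (v + 1)) where
  State : Type v
  init : State
  term : State
  edge : State → X → State → Prop

namespace Automaton

variable {X : Type u}

/-- `B.Path p w q`: the word `w` labels a path from `p` to `q`. -/
def Path (B : Automaton.{u, v} X) : B.State → List X → B.State → Prop
  | p, [], q => p = q
  | p, x :: w, q => ∃ r, B.edge p x r ∧ Path B r w q

/-- A morphism of automata. -/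
structure Hom (B : Automaton.{u, v} X) (C : Automaton.{u, v'} X) where
  toFun : B.State → C.State
  map_init : toFun B.init = C.init
  map_term : toFun B.term = C.term
  map_edge : ∀ p x q, B.edge p x q → C.edge (toFun p) x (toFun q)

/-- Composition of morphisms (first `f`, then `g`). -/
def Hom.comp {B C D : Automaton.{u, v} X} (f : Hom B C) (g : Hom C D) : Hom B D where
  toFun s := g.toFun (f.toFun s)
  map_init := by rw [f.map_init, g.map_init]
  map_term := by rw [f.map_term, g.map_term]
  map_edge p x q h := g.map_edge _ _ _ (f.map_edge _ _ _ h)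

/-- An isomorphism of automata: a bijection of the states that matches initial states, terminal
states and transitions. -/
structure Iso (B : Automaton.{u, v} X) (C : Automaton.{u, v'} X) where
  toEquiv : B.State ≃ C.State
  map_init : toEquiv B.init = C.init
  map_term : toEquiv B.term = C.term
  map_edge : ∀ p x q, B.edge p x q ↔ C.edge (toEquiv p) x (toEquiv q)

/-- An isomorphism as a morphism. -/
def Iso.toHom {B : Automaton.{u, v} X} {C : Automaton.{u, v'} X} (e : Iso B C) : Hom B C where
  toFun := e.toEquiv
  map_init := e.map_init
  map_term := e.map_term
  map_edge p x q := (e.map_edge p x q).1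

/-- The automaton obtained by identifying states along (the equivalence relation generated by) `r`;
its transitions are the images of those of `B`. -/
def quot (B : Automaton.{u, v} X) (r : B.State → B.State → Prop) : Automaton.{u, v} X where
  State := Quot r
  init := Quot.mk r B.init
  term := Quot.mk r B.term
  edge P x Q := ∃ p q, Quot.mk r p = P ∧ Quot.mk r q = Q ∧ B.edge p x q

/-- The projection onto a quotient automaton. -/
def toQuot (B : Automaton.{u, v} X) (r : B.State → B.State → Prop) : Hom B (B.quot r) where
  toFun := Quot.mk r
  map_init := rfl
  map_term := rfl
  map_edge p _ q h := ⟨p, q, rfl, rfl, h⟩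

/-! ### Folding -/

/-- The states that get identified when one successively identifies the ends `q`, `q'` of any two
transitions with the same label and the same origin: the least equivalence relation `~` such that
`p ~ p'`, `p → q`, `p' → q'` (same label) imply `q ~ q'`. -/
inductive FoldRel (B : Automaton.{u, v} X) : B.State → B.State → Prop
  | refl (p) : FoldRel B p p
  | symm {p q} : FoldRel B p q → FoldRel B q p
  | trans {p q r} : FoldRel B p q → FoldRel B q r → FoldRel B p r
  | fold {p p' q q'} (x : X) :
      FoldRel B p p' → B.edge p x q → B.edge p' x q' → FoldRel B q q'

/-- `Fold(B)`. -/
def fold (B : Automaton.{u, v} X) : Automaton.{u, v} X := B.quot B.FoldRel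

/-- The relation used to identify the two states `q` and `q'`. -/
def Single (B : Automaton.{u, v} X) (q q' : B.State) : B.State → B.State → Prop :=
  fun s t => s = q ∧ t = q'

/-! ### Elementary expansions -/

/-- The linear automaton of the word `w`, with the positions `0, …, |w|` in `w` (that is, its
prefixes) as states. -/
def lin {A : Type u} (w : List (Letter A)) : Automaton.{u, 0} (Letter A) where
  State := Fin (w.length + 1)
  init := 0
  term := Fin.last w.length
  edge p x q :=
    (q.val = p.val + 1 ∧ w[p.val]? = some x) ∨ (p.val = q.val + 1 ∧ w[q.val]? = some x.inv)

/-- The disjoint union of `B` and the linear automaton of `w`; initial and terminal state are those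
of `B`. -/
def sumLin {A : Type u} (B : Automaton.{u, v} (Letter A)) (w : List (Letter A)) :
    Automaton.{u, v} (Letter A) where
  State := B.State ⊕ (lin w).State
  init := Sum.inl B.init
  term := Sum.inl B.term
  edge s x t :=
    match s, t with
    | Sum.inl p, Sum.inl q => B.edge p x q
    | Sum.inr p, Sum.inr q => (lin w).edge p x q
    | _, _ => False

/-- The identifications that glue the ends of the linear automaton of `w` to `q₁` and `q₂`. -/
inductive Glue {A : Type u} (B : Automaton.{u, v} (Letter A)) (q₁ q₂ : B.State)
    (w : List (Letter A)) : (B.sumLin w).State → (B.sumLin w).State → Prop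
  | left : Glue B q₁ q₂ w (Sum.inl q₁) (Sum.inr (lin w).init)
  | right : Glue B q₁ q₂ w (Sum.inl q₂) (Sum.inr (lin w).term)

/-- `B` with a new path from `q₁` to `q₂` labelled `w` (and the inverse path) added: the inner
states of the path are new. For the empty word, `q₁` and `q₂` become identified. -/
def addPath {A : Type u} (B : Automaton.{u, v} (Letter A)) (q₁ q₂ : B.State)
    (w : List (Letter A)) : Automaton.{u, v} (Letter A) :=
  (B.sumLin w).quot (Glue B q₁ q₂ w)

/-- The canonical morphism from `B` to `B` with a path added. -/
def toAddPath {A : Type u} (B : Automaton.{u, v} (Letter A)) (q₁ q₂ : B.State)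
    (w : List (Letter A)) : Hom B (B.addPath q₁ q₂ w) where
  toFun p := Quot.mk _ (Sum.inl p)
  map_init := rfl
  map_term := rfl
  map_edge p _ q h := ⟨Sum.inl p, Sum.inl q, rfl, rfl, h⟩

/-! ### The closure -/

/-- The morphisms of Stephen's system with respect to `R`: the finite composites of elementary
expansions (add a path `q₁ → q₂` labelled `u` where there is a path `q₁ → q₂` labelled `v`, with
`(u, v) ∈ R` or `(v, u) ∈ R`), of foldings of two edges (identify `q` and `q'` where `q ← p → q'`
carry the same label), and of isomorphisms. -/
inductive StephenMap {A : Type u} (R : Set (Word A × Word A)) :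
    ∀ {C D : Automaton.{u, v} (Letter A)}, Hom C D → Prop
  | expansion (C : Automaton.{u, v} (Letter A)) (q₁ q₂ : C.State) (u v : Word A) :
      (u, v) ∈ R ∨ (v, u) ∈ R → C.Path q₁ v.toList q₂ →
        StephenMap R (C.toAddPath q₁ q₂ u.toList)
  | folding (C : Automaton.{u, v} (Letter A)) (p q q' : C.State) (x : Letter A) :
      C.edge p x q → C.edge p x q' → StephenMap R (C.toQuot (C.Single q q'))
  | iso {C D : Automaton.{u, v} (Letter A)} (e : Iso C D) : StephenMap R e.toHom
  | comp {C D E : Automaton.{u, v} (Letter A)} {f : Hom C D} {g : Hom D E} :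
      StephenMap R f → StephenMap R g → StephenMap R (f.comp g)

/-- The objects of Stephen's directed system of `B` with respect to `R`: the automata obtained from
`B` by a finite sequence of elementary expansions and foldings, together with the resulting
morphism from `B`. -/
structure StephenObj {A : Type u} (R : Set (Word A × Word A))
    (B : Automaton.{u, v} (Letter A)) : Type (max u (v + 1)) where
  aut : Automaton.{u, v} (Letter A)
  map : Hom B aut
  isMap : StephenMap R map

/-- The object `B` itself of its directed system. -/
def StephenObj.base {A : Type u} (R : Set (Word A × Word A)) (B : Automaton.{u, v} (Letter A)) :
    StephenObj R B where
  aut := B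
  map := Iso.toHom ⟨Equiv.refl _, rfl, rfl, fun _ _ _ => Iff.rfl⟩
  isMap := StephenMap.iso _

/-- The identifications that define the colimit: a state is identified with its image under any
morphism of the directed system. -/
inductive ColimRel {A : Type u} (R : Set (Word A × Word A)) (B : Automaton.{u, v} (Letter A)) :
    (Σ O : StephenObj R B, O.aut.State) → (Σ O : StephenObj R B, O.aut.State) → Prop
  | step (O P : StephenObj R B) (h : Hom O.aut P.aut) (hh : StephenMap R h)
      (comm : O.map.comp h = P.map) (s : O.aut.State) :
      ColimRel R B ⟨O, s⟩ ⟨P, h.toFun s⟩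

/-- The closure `Cl_R(B)`: the colimit of the directed system of all the automata obtained from `B`
by finite sequences of elementary expansions and foldings. Its states are those of the objects of
the system modulo the morphisms of the system, and its transitions are the images of the
transitions of the objects. -/
def closure {A : Type u} (R : Set (Word A × Word A)) (B : Automaton.{u, v} (Letter A)) :
    Automaton.{u, max u (v + 1)} (Letter A) where
  State := Quot (ColimRel R B)
  init := Quot.mk _ ⟨StephenObj.base R B, B.init⟩
  term := Quot.mk _ ⟨StephenObj.base R B, B.term⟩
  edge S x T := ∃ (O : StephenObj R B) (s t : O.aut.State),
    Quot.mk _ ⟨O, s⟩ = S ∧ Quot.mk _ ⟨O, t⟩ = T ∧ O.aut.edge s x t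

/-! ### Contraction -/

/-- The automaton on the alphabet without `a`, `a⁻¹` obtained by identifying `p` and `q` for each
transition `p → q` labelled `a` and erasing the loops labelled `a` and `a⁻¹` that result. -/
def collapse {A : Type u} (a : A) (B : Automaton.{u, v} (Letter A)) :
    Automaton.{u, v} (Letter {b : A // b ≠ a}) where
  State := (B.quot fun p q => B.edge p (a, true) q).State
  init := (B.quot fun p q => B.edge p (a, true) q).init
  term := (B.quot fun p q => B.edge p (a, true) q).term
  edge P x Q := (B.quot fun p q => B.edge p (a, true) q).edge P (x.1.val, x.2) Q

/-- The `a`-contracted automaton `χ_a(B)`. -/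
def contract {A : Type u} (a : A) (B : Automaton.{u, v} (Letter A)) :
    Automaton.{u, v} (Letter {b : A // b ≠ a}) :=
  (B.collapse a).fold

end Automaton

/-! ## Schützenberger automata -/

theorem greenR_self_inv {A : Type u} (R : Set (Word A × Word A)) (w : Word A) :
    GreenR (cls R (w * w.inv)) (cls R w) := by
  refine ⟨⟨cls R w.inv, rfl⟩, ⟨cls R w, ?_⟩⟩
  have h : presCon R (w * w.inv * w) w :=
    ConGen.Rel.of _ _ (Or.inl (ConGen.Rel.of _ _ (VagnerRel.regular w)))
  exact ((presCon R).eq.2 h).symm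

/-- The Schützenberger automaton `𝒜(w)` with respect to `Inv⟨A | R⟩`: the subgraph of the Cayley
graph induced by the `𝓡`-class of the class of `w`, with initial state the class of `w w⁻¹` and
terminal state the class of `w`. -/
def schutzenberger {A : Type u} (R : Set (Word A × Word A)) (w : Word A) :
    Automaton.{u, u} (Letter A) where
  State := {m : PresMonoid R // GreenR m (cls R w)}
  init := ⟨cls R (w * w.inv), greenR_self_inv R w⟩
  term := ⟨cls R w, ⟨1, (mul_one _).symm⟩, ⟨1, (mul_one _).symm⟩⟩
  edge m x n := n.val = m.val * cls R (FreeMonoid.of x)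

/-! ## Erasing a letter -/

open Classical in
/-- The homomorphism `θ` erasing the letters `a` and `a⁻¹` and fixing all others. -/
noncomputable def erase {A : Type u} (a : A) : Word A →* Word {b : A // b ≠ a} :=
  FreeMonoid.lift fun x =>
    if h : x.1 = a then 1 else FreeMonoid.of ((⟨x.1, h⟩ : {b : A // b ≠ a}), x.2)

/-- The relation `R θ̄ = {(uθ, vθ) | (u, v) ∈ R}`. -/
def eraseRel {A : Type u} (a : A) (R : Set (Word A × Word A)) :
    Set (Word {b : A // b ≠ a} × Word {b : A // b ≠ a}) :=
  Prod.map (erase a) (erase a) '' R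

end InvPres

namespace InvPres

/-! Both sides satisfy the same characterisation. In a deterministic involutive automaton that is
closed under expansions, words equal in the presented inverse monoid label the same paths
(`presCon_le_actionCon`). Hence such an automaton, if it is also accessible, accepts `w` and maps to
the Schützenberger automaton of `w`, is isomorphic to it (`nonempty_iso_schutzenberger`).

The closure of the contracted automaton meets these conditions for the erased word. Determinism and
closedness hold because finitely many states and edges of the colimit already live in one object of
Stephen's system, where the required folding or expansion can be carried out. This needs
directedness, which comes from stability of the system's morphisms under pushout
(`StephenMap.exists_isPushout`, `StephenMap.ore`). Accessibility, involutivity and the accepted word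
pass from `𝒜(w)` to its contraction and then to the closure.

The morphism to `𝒜(wθ)` starts from the monoid homomorphism induced by erasing `a`. It factors
through the contraction because the target is deterministic, and through the closure because the
target is also involutive and closed (`closure_nonempty_hom`). -/

theorem Letter.inv_inv {A : Type u} (x : Letter A) : x.inv.inv = x := by
  simp [Letter.inv]

/-! ### Paths, determinism, accessibility and quotients -/

namespace Automaton

variable {X : Type u}

theorem Hom.ext_toFun {B : Automaton.{u, v} X} {C : Automaton.{u, v'} X} {f g : Hom B C}
    (h : ∀ s, f.toFun s = g.toFun s) : f = g := by
  cases f; cases g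
  congr
  exact funext h

theorem Hom.congr_toFun {B : Automaton.{u, v} X} {C : Automaton.{u, v'} X} {f g : Hom B C}
    (h : f = g) (s : B.State) : f.toFun s = g.toFun s := by rw [h]

theorem Hom.path {B : Automaton.{u, v} X} {C : Automaton.{u, v'} X} (f : Hom B C)
    {p : B.State} {w : List X} {q : B.State} (h : B.Path p w q) :
    C.Path (f.toFun p) w (f.toFun q) := by
  induction w generalizing p with
  | nil => exact congrArg f.toFun h
  | cons x w ih =>
    obtain ⟨r, h₁, h₂⟩ := h
    exact ⟨f.toFun r, f.map_edge _ _ _ h₁, ih h₂⟩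

theorem path_append (B : Automaton.{u, v} X) {p : B.State} {w₁ w₂ : List X} {q : B.State} :
    B.Path p (w₁ ++ w₂) q ↔ ∃ r, B.Path p w₁ r ∧ B.Path r w₂ q := by
  induction w₁ generalizing p with
  | nil => simp [Path]
  | cons x w ih =>
    simp only [List.cons_append, Path, ih]
    grind

theorem path_singleton (B : Automaton.{u, v} X) {p : B.State} {x : X} {q : B.State} :
    B.Path p [x] q ↔ B.edge p x q := by
  simp [Path]

/-- Every label of a path can be read along a sequence of states. -/
theorem Path.exists_seq {B : Automaton.{u, v} X} {p : B.State} {w : List X} {q : B.State}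
    (h : B.Path p w q) :
    ∃ g : ℕ → B.State, g 0 = p ∧ g w.length = q ∧
      ∀ i x, w[i]? = some x → B.edge (g i) x (g (i + 1)) := by
  induction w generalizing p with
  | nil => exact ⟨fun _ => p, rfl, h, by simp⟩
  | cons x w ih =>
    obtain ⟨r, h₁, h₂⟩ := h
    obtain ⟨g, hg₀, hg₁, hg⟩ := ih h₂
    refine ⟨fun i => Nat.casesOn i p g, rfl, hg₁, ?_⟩
    rintro (_ | i) y hy
    · simp only [List.getElem?_cons_zero, Option.some.injEq] at hy
      subst hy
      simpa [hg₀] using h₁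
    · exact hg i y (by simpa using hy)

/-- A sequence of states along which `w` can be read is a path. -/
theorem path_of_seq {B : Automaton.{u, v} X} (w : List X) (g : ℕ → B.State)
    (hg : ∀ i x, w[i]? = some x → B.edge (g i) x (g (i + 1))) :
    B.Path (g 0) w (g w.length) := by
  induction w generalizing g with
  | nil => rfl
  | cons x w ih =>
    exact ⟨g 1, hg 0 x rfl, ih (fun i => g (i + 1)) fun i y hy => hg (i + 1) y (by simpa using hy)⟩

/-- Transitions with the same origin and label have the same end. -/
def Deterministic (B : Automaton.{u, v} X) : Prop :=
  ∀ ⦃p x q q'⦄, B.edge p x q → B.edge p x q' → q = q'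

theorem Deterministic.path_unique {B : Automaton.{u, v} X} (hB : B.Deterministic)
    {p : B.State} {w : List X} {q q' : B.State} (h : B.Path p w q) (h' : B.Path p w q') :
    q = q' := by
  induction w generalizing p with
  | nil => exact h.symm.trans h'
  | cons x w ih =>
    obtain ⟨r, h₁, h₂⟩ := h
    obtain ⟨r', h₁', h₂'⟩ := h'
    obtain rfl := hB h₁ h₁'
    exact ih h₂ h₂'

/-- Every state can be reached from the initial state. -/
def Accessible (B : Automaton.{u, v} X) : Prop :=
  ∀ q, ∃ w, B.Path B.init w q

theorem Accessible.quot {B : Automaton.{u, v} X} (hB : B.Accessible)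
    (r : B.State → B.State → Prop) : (B.quot r).Accessible := by
  rintro ⟨q⟩
  obtain ⟨w, hw⟩ := hB q
  exact ⟨w, (B.toQuot r).path hw⟩

/-- The morphism from a quotient induced by a morphism that respects the identifications. -/
def quotDesc {B : Automaton.{u, v} X} {C : Automaton.{u, v'} X} (r : B.State → B.State → Prop)
    (f : Hom B C) (h : ∀ p q, r p q → f.toFun p = f.toFun q) : Hom (B.quot r) C where
  toFun := Quot.lift f.toFun h
  map_init := f.map_init
  map_term := f.map_term
  map_edge := by
    rintro _ x _ ⟨p, q, rfl, rfl, e⟩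
    exact f.map_edge _ _ _ e

/-- Each generating identification is forced by determinism of the target, so morphisms to
deterministic automata factor through `fold`. -/
theorem FoldRel.map_eq {B : Automaton.{u, v} X} {C : Automaton.{u, v'} X}
    (hC : C.Deterministic) (f : Hom B C) {p q : B.State} (h : B.FoldRel p q) :
    f.toFun p = f.toFun q := by
  induction h with
  | refl => rfl
  | symm _ ih => exact ih.symm
  | trans _ _ ih₁ ih₂ => exact ih₁.trans ih₂
  | fold x _ e e' ih =>
    have h₁ := f.map_edge _ _ _ e
    rw [ih] at h₁
    exact hC h₁ (f.map_edge _ _ _ e')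

/-- The inverse of an isomorphism. -/
def Iso.symm {B : Automaton.{u, v} X} {C : Automaton.{u, v'} X} (e : Iso B C) : Iso C B where
  toEquiv := e.toEquiv.symm
  map_init := by rw [← e.map_init, Equiv.symm_apply_apply]
  map_term := by rw [← e.map_term, Equiv.symm_apply_apply]
  map_edge p x q := by rw [e.map_edge]; simp

/-- The identity morphism. -/
def Hom.id (B : Automaton.{u, v} X) : Hom B B where
  toFun := fun s => s
  map_init := rfl
  map_term := rfl
  map_edge _ _ _ h := h

/-! ### Inverse automata -/

section Inverse

variable {A : Type u}

/-- Transitions come in mutually inverse pairs. -/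
def Involutive (B : Automaton.{u, v} (Letter A)) : Prop :=
  ∀ ⦃p x q⦄, B.edge p x q → B.edge q x.inv p

theorem Involutive.quot {B : Automaton.{u, v} (Letter A)} (hB : B.Involutive)
    (r : B.State → B.State → Prop) : (B.quot r).Involutive := by
  rintro _ x _ ⟨p, q, rfl, rfl, e⟩
  exact ⟨q, p, rfl, rfl, hB e⟩

theorem Involutive.path_inv {B : Automaton.{u, v} (Letter A)} (hB : B.Involutive)
    {p : B.State} {w : Word A} {q : B.State} (h : B.Path p w.toList q) :
    B.Path q w.inv.toList p := by
  change B.Path q (w.toList.map Letter.inv).reverse p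
  generalize w.toList = l at h
  induction l generalizing p with
  | nil => exact h.symm
  | cons x l ih =>
    obtain ⟨r, h₁, h₂⟩ := h
    rw [List.map_cons, List.reverse_cons, path_append]
    exact ⟨r, ih h₂, (path_singleton B).2 (hB h₁)⟩

theorem Involutive.sumLin {B : Automaton.{u, v} (Letter A)} (hB : B.Involutive)
    (w : List (Letter A)) : (B.sumLin w).Involutive := by
  rintro (p | p) x (q | q) h
  · exact hB h
  · exact h
  · exact h
  · rcases h with h | h
    · exact Or.inr ⟨h.1, by rw [Letter.inv_inv]; exact h.2⟩
    · exact Or.inl h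

/-- Closure under elementary expansions with respect to `R`. -/
def ExpansionClosed (R : Set (Word A × Word A)) (B : Automaton.{u, v} (Letter A)) : Prop :=
  ∀ ⦃p q u v⦄, (u, v) ∈ R ∨ (v, u) ∈ R → B.Path p v.toList q → B.Path p u.toList q

/-- The words with the same action on the states of an automaton. -/
def actionCon (B : Automaton.{u, v} (Letter A)) : Con (Word A) where
  r u v := ∀ p q, B.Path p u.toList q ↔ B.Path p v.toList q
  iseqv := ⟨fun _ _ _ => Iff.rfl, fun h p q => (h p q).symm,
    fun h h' p q => (h p q).trans (h' p q)⟩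
  mul' := by
    intro u u' v v' h h' p q
    simp only [FreeMonoid.toList_mul, path_append, h _ _, h' _ _]

/-- Reading `w` and then its inverse retraces the path, and by determinism it can end nowhere else.
So `w w⁻¹` acts as the identity restricted to the domain of `w`. -/
theorem path_mul_inv {B : Automaton.{u, v} (Letter A)} (hd : B.Deterministic)
    (hi : B.Involutive) {p q : B.State} {w : Word A} :
    B.Path p (w * w.inv).toList q ↔ p = q ∧ ∃ r, B.Path p w.toList r := by
  rw [FreeMonoid.toList_mul, path_append]
  constructor
  · rintro ⟨r, h₁, h₂⟩
    exact ⟨hd.path_unique (hi.path_inv h₁) h₂, r, h₁⟩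
  · rintro ⟨rfl, r, h⟩
    exact ⟨r, h, hi.path_inv h⟩

/-- It suffices to check generators. The Vagner pairs hold since restrictions of the identity
commute and `w w⁻¹` is the identity where `w` is defined; the pairs of `R` hold by closedness, used
in both directions. -/
theorem presCon_le_actionCon {R : Set (Word A × Word A)} {B : Automaton.{u, v} (Letter A)}
    (hd : B.Deterministic) (hi : B.Involutive) (hc : B.ExpansionClosed R) :
    presCon R ≤ B.actionCon := by
  refine Con.conGen_le.2 ?_
  rintro u v (h | h)
  · refine (Con.conGen_le (c := B.actionCon)).2 ?_ h
    rintro _ _ (w | ⟨u, v⟩) p q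
    · rw [FreeMonoid.toList_mul, path_append]
      simp only [path_mul_inv hd hi]
      grind
    · rw [FreeMonoid.toList_mul (u * u.inv), FreeMonoid.toList_mul (v * v.inv), path_append,
        path_append]
      simp only [path_mul_inv hd hi]
      grind
  · exact fun p q => ⟨hc (Or.inr h), hc (Or.inl h)⟩

end Inverse

end Automaton

end InvPres

namespace InvPres

namespace Automaton

/-! ### Pushouts and Stephen's directed system -/

section Pushout

variable {X : Type u}

/-- The square `f ≫ h = g ≫ k` is a pushout of automata. -/
structure IsPushout {C D E F : Automaton.{u, v} X} (f : Hom C D) (g : Hom C E)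
    (h : Hom D F) (k : Hom E F) : Prop where
  comm : f.comp h = g.comp k
  desc : ∀ {Z : Automaton.{u, v} X} (p : Hom D Z) (q : Hom E Z), f.comp p = g.comp q →
    ∃ r : Hom F Z, h.comp r = p ∧ k.comp r = q
  uniq : ∀ {Z : Automaton.{u, v} X} (r r' : Hom F Z), h.comp r = h.comp r' →
    k.comp r = k.comp r' → r = r'

theorem IsPushout.flip {C D E F : Automaton.{u, v} X} {f : Hom C D} {g : Hom C E}
    {h : Hom D F} {k : Hom E F} (H : IsPushout f g h k) : IsPushout g f k h where
  comm := H.comm.symm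
  desc p q e := (H.desc q p e.symm).imp fun _ h => h.symm
  uniq r r' e e' := H.uniq r r' e' e

theorem IsPushout.paste {C D E F D' F' : Automaton.{u, v} X} {f : Hom C D} {g : Hom C E}
    {h : Hom D F} {k : Hom E F} {f' : Hom D D'} {h' : Hom D' F'} {k' : Hom F F'}
    (H : IsPushout f g h k) (H' : IsPushout f' h h' k') :
    IsPushout (f.comp f') g h' (k.comp k') where
  comm := by
    change f.comp (f'.comp h') = (g.comp k).comp k'
    rw [H'.comm, ← H.comm]
    rfl
  desc p q e := by
    obtain ⟨r, h₁, h₂⟩ := H.desc (f'.comp p) q e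
    obtain ⟨r', h₃, h₄⟩ := H'.desc p r h₁.symm
    refine ⟨r', h₃, ?_⟩
    change k.comp (k'.comp r') = q
    rw [h₄, h₂]
  uniq r r' e e' := by
    refine H'.uniq r r' e (H.uniq _ _ ?_ e')
    change (h.comp k').comp r = (h.comp k').comp r'
    rw [← H'.comm]
    exact congrArg f'.comp e

theorem IsPushout.exists_iso {C D E F F' : Automaton.{u, v} X} {f : Hom C D} {g : Hom C E}
    {h : Hom D F} {k : Hom E F} {h' : Hom D F'} {k' : Hom E F'}
    (H : IsPushout f g h k) (H' : IsPushout f g h' k') :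
    ∃ e : Iso F F', h.comp e.toHom = h' ∧ k.comp e.toHom = k' := by
  obtain ⟨r, h₁, h₂⟩ := H.desc h' k' H'.comm
  obtain ⟨r', h₁', h₂'⟩ := H'.desc h k H.comm
  have e₁ : r.comp r' = Hom.id F := by
    refine H.uniq _ _ ?_ ?_
    · change (h.comp r).comp r' = h
      rw [h₁, h₁']
    · change (k.comp r).comp r' = k
      rw [h₂, h₂']
  have e₂ : r'.comp r = Hom.id F' := by
    refine H'.uniq _ _ ?_ ?_
    · change (h'.comp r').comp r = h'
      rw [h₁', h₁]
    · change (k'.comp r').comp r = k'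
      rw [h₂', h₂]
  refine ⟨⟨⟨r.toFun, r'.toFun, Hom.congr_toFun e₁, Hom.congr_toFun e₂⟩, r.map_init, r.map_term,
    fun p x q => ⟨r.map_edge p x q, fun e => ?_⟩⟩, h₁, h₂⟩
  -- A bijective morphism need not reflect transitions; here the inverse is itself a morphism.
  have : F.edge (r'.toFun (r.toFun p)) x (r'.toFun (r.toFun q)) := r'.map_edge _ _ _ e
  rwa [show r'.toFun (r.toFun p) = p from Hom.congr_toFun e₁ p,
    show r'.toFun (r.toFun q) = q from Hom.congr_toFun e₁ q] at this

/-- Pushing an identification of two states along `g` identifies their images, so a folding is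
pushed out to a folding. -/
theorem isPushout_toQuot_single {C E : Automaton.{u, v} X} (g : Hom C E) (q q' : C.State) :
    IsPushout (C.toQuot (C.Single q q')) g
      (quotDesc _ (g.comp (E.toQuot (E.Single (g.toFun q) (g.toFun q')))) (by
        rintro _ _ ⟨rfl, rfl⟩
        exact Quot.sound ⟨rfl, rfl⟩))
      (E.toQuot (E.Single (g.toFun q) (g.toFun q'))) where
  comm := rfl
  desc r s e := by
    have e' := Hom.congr_toFun e
    refine ⟨quotDesc _ s ?_, Hom.ext_toFun ?_, rfl⟩
    · rintro _ _ ⟨rfl, rfl⟩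
      refine (e' q).symm.trans (Eq.trans ?_ (e' q'))
      exact congrArg r.toFun (Quot.sound ⟨rfl, rfl⟩)
    · rintro ⟨p⟩
      exact (e' p).symm
  uniq r r' _ e := by
    refine Hom.ext_toFun ?_
    rintro ⟨p⟩
    exact Hom.congr_toFun e p

theorem isPushout_iso {C D E : Automaton.{u, v} X} (i : Iso C D) (g : Hom C E) :
    IsPushout i.toHom g (i.symm.toHom.comp g) (Hom.id E) where
  comm := Hom.ext_toFun fun s => congrArg g.toFun (i.toEquiv.symm_apply_apply s)
  desc p q e := by
    refine ⟨q, Hom.ext_toFun fun s => ?_, rfl⟩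
    have := Hom.congr_toFun e (i.toEquiv.symm s)
    refine this.symm.trans (congrArg p.toFun (i.toEquiv.apply_symm_apply s))
  uniq _ _ _ e := e

end Pushout

/-! ### Elementary expansions as pushouts, and directedness -/

variable {A : Type u}

/-- The morphism from `B` with a path added that is given on `B` and on the new path. -/
def addPathDesc {B : Automaton.{u, v} (Letter A)} {Z : Automaton.{u, v'} (Letter A)}
    {q₁ q₂ : B.State} {w : List (Letter A)} (f : Hom B Z) (g : (lin w).State → Z.State)
    (hg : ∀ p x q, (lin w).edge p x q → Z.edge (g p) x (g q))
    (h₁ : f.toFun q₁ = g (lin w).init) (h₂ : f.toFun q₂ = g (lin w).term) :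
    Hom (B.addPath q₁ q₂ w) Z :=
  quotDesc (B := B.sumLin w) (Glue B q₁ q₂ w)
    { toFun := Sum.elim f.toFun g
      map_init := f.map_init
      map_term := f.map_term
      map_edge := by
        rintro (p | p) x (q | q) h
        · exact f.map_edge _ _ _ h
        · exact h.elim
        · exact h.elim
        · exact hg _ _ _ h }
    (by
      rintro _ _ (_ | _)
      · exact h₁
      · exact h₂)

theorem addPath_edge_inr (B : Automaton.{u, v} (Letter A)) (q₁ q₂ : B.State)
    {w : List (Letter A)} {p : (lin w).State} {x : Letter A} {q : (lin w).State}
    (h : (lin w).edge p x q) :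
    (B.addPath q₁ q₂ w).edge (Quot.mk _ (Sum.inr p)) x (Quot.mk _ (Sum.inr q)) :=
  ⟨Sum.inr p, Sum.inr q, rfl, rfl, h⟩

theorem isPushout_toAddPath {C E : Automaton.{u, v} (Letter A)} (g : Hom C E) (q₁ q₂ : C.State)
    (w : List (Letter A)) :
    IsPushout (C.toAddPath q₁ q₂ w) g
      (addPathDesc (g.comp (E.toAddPath (g.toFun q₁) (g.toFun q₂) w))
        (fun i => Quot.mk _ (Sum.inr i)) (fun _ _ _ h => addPath_edge_inr E _ _ h)
        (Quot.sound Glue.left) (Quot.sound Glue.right))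
      (E.toAddPath (g.toFun q₁) (g.toFun q₂) w) where
  comm := rfl
  desc r s e := by
    have e' := Hom.congr_toFun e
    refine ⟨addPathDesc s (fun i => r.toFun (Quot.mk _ (Sum.inr i)))
      (fun _ _ _ h => r.map_edge _ _ _ (addPath_edge_inr C _ _ h)) ?_ ?_, Hom.ext_toFun ?_, rfl⟩
    · exact (e' q₁).symm.trans (congrArg r.toFun (Quot.sound Glue.left))
    · exact (e' q₂).symm.trans (congrArg r.toFun (Quot.sound Glue.right))
    · rintro ⟨p | p⟩
      · exact (e' p).symm
      · rfl
  uniq r r' e' e := by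
    refine Hom.ext_toFun ?_
    rintro ⟨p | p⟩
    · exact Hom.congr_toFun e p
    · exact Hom.congr_toFun e' (Quot.mk _ (Sum.inr p))

variable {R : Set (Word A × Word A)}

/-- Morphisms preserve paths and edges, so the move made on `C` is equally allowed on `E`;
composites follow by pasting squares. Only the leg `k` opposite `f` is claimed to belong to the
system, as `g` is arbitrary. -/
theorem StephenMap.exists_isPushout {C D E : Automaton.{u, v} (Letter A)} {f : Hom C D}
    (hf : StephenMap R f) (g : Hom C E) :
    ∃ (F : Automaton.{u, v} (Letter A)) (h : Hom D F) (k : Hom E F),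
      StephenMap R k ∧ IsPushout f g h k := by
  induction hf generalizing E with
  | expansion C q₁ q₂ u v huv hp =>
    exact ⟨_, _, _, StephenMap.expansion E _ _ u v huv (g.path hp),
      isPushout_toAddPath g q₁ q₂ u.toList⟩
  | folding C p q q' x h h' =>
    exact ⟨_, _, _, StephenMap.folding E _ _ _ x (g.map_edge _ _ _ h) (g.map_edge _ _ _ h'),
      isPushout_toQuot_single g q q'⟩
  | iso i =>
    exact ⟨_, _, _, StephenMap.iso ⟨Equiv.refl _, rfl, rfl, fun _ _ _ => Iff.rfl⟩,
      isPushout_iso i g⟩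
  | comp _ _ ih₁ ih₂ =>
    obtain ⟨_, h, k, hk, H⟩ := ih₁ g
    obtain ⟨_, h', k', hk', H'⟩ := ih₂ h
    exact ⟨_, _, _, hk.comp hk', H.paste H'⟩

/-- Two morphisms of Stephen's system with the same source can be completed to a square. -/
theorem StephenMap.ore {C D E : Automaton.{u, v} (Letter A)} {f : Hom C D} {g : Hom C E}
    (hf : StephenMap R f) (hg : StephenMap R g) :
    ∃ (F : Automaton.{u, v} (Letter A)) (h : Hom D F) (k : Hom E F),
      StephenMap R h ∧ StephenMap R k ∧ f.comp h = g.comp k := by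
  -- Pushing out `f` along `g` and `g` along `f` puts one leg each in the system; uniqueness of
  -- pushouts places both in one square.
  obtain ⟨F, h, k, hk, H⟩ := hf.exists_isPushout g
  obtain ⟨F', k', h', hh', H'⟩ := hg.exists_isPushout f
  obtain ⟨e, rfl, -⟩ := H'.flip.exists_iso H
  exact ⟨F, _, k, hh'.comp (StephenMap.iso e), hk, H.comm⟩

theorem path_addPath (B : Automaton.{u, v} (Letter A)) (q₁ q₂ : B.State)
    (w : List (Letter A)) (i : (lin w).State) :
    ∃ w₁ w₂, w = w₁ ++ w₂ ∧
      (B.addPath q₁ q₂ w).Path (Quot.mk _ (Sum.inl q₁)) w₁ (Quot.mk _ (Sum.inr i)) ∧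
      (B.addPath q₁ q₂ w).Path (Quot.mk _ (Sum.inr i)) w₂ (Quot.mk _ (Sum.inl q₂)) := by
  have hl : (Quot.mk _ (Sum.inl q₁) : (B.addPath q₁ q₂ w).State) =
    Quot.mk _ (Sum.inr (lin w).init) := Quot.sound Glue.left
  have hr : (Quot.mk _ (Sum.inl q₂) : (B.addPath q₁ q₂ w).State) =
    Quot.mk _ (Sum.inr (lin w).term) := Quot.sound Glue.right
  obtain ⟨i, hi⟩ := i
  -- Truncating by `min` makes the sequence of positions total; indices beyond the length of `w` are
  -- never read.
  let g : ℕ → (B.addPath q₁ q₂ w).State := fun j =>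
    Quot.mk _ (Sum.inr ⟨min j w.length, by omega⟩)
  have hg : ∀ j x, w[j]? = some x → (B.addPath q₁ q₂ w).edge (g j) x (g (j + 1)) := by
    intro j x hx
    have hj : j < w.length := (List.getElem?_eq_some_iff.1 hx).1
    refine addPath_edge_inr _ _ _ (Or.inl ⟨?_, ?_⟩)
    · simp only; omega
    · simpa [min_eq_left hj.le] using hx
  have hmk : ∀ j (k : (lin w).State), min j w.length = k.val → g j = Quot.mk _ (Sum.inr k) :=
    fun j k h => congrArg (fun k => Quot.mk _ (Sum.inr k)) (Fin.ext h)
  refine ⟨w.take i, w.drop i, (List.take_append_drop i w).symm, ?_, ?_⟩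
  · have := path_of_seq (w.take i) g fun j x hx => hg j x (by
      rw [List.getElem?_take] at hx
      split_ifs at hx
      exact hx)
    rwa [hmk 0 (lin w).init (Nat.zero_min _), ← hl,
      hmk _ ⟨i, hi⟩ (by rw [List.length_take]; change _ = i; omega)] at this
  · have := path_of_seq (w.drop i) (fun j => g (i + j)) fun j x hx => hg (i + j) x (by
      rwa [List.getElem?_drop] at hx)
    rwa [hmk (i + 0) ⟨i, hi⟩ (by change _ = i; omega), hmk _ (lin w).term (by
      rw [List.length_drop]; change _ = w.length; omega), ← hr] at this

/-! ### Invariants and extension properties of Stephen's morphisms -/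

theorem StephenMap.involutive {C D : Automaton.{u, v} (Letter A)} {f : Hom C D}
    (hf : StephenMap R f) (hC : C.Involutive) : D.Involutive := by
  induction hf with
  | expansion C q₁ q₂ u v _ _ => exact (hC.sumLin _).quot _
  | folding => exact hC.quot _
  | iso i =>
    intro p x q h
    have := hC ((i.symm.map_edge p x q).1 h)
    exact (i.symm.map_edge _ _ _).2 this
  | comp _ _ ih₁ ih₂ => exact ih₂ (ih₁ hC)

theorem StephenMap.accessible {C D : Automaton.{u, v} (Letter A)} {f : Hom C D}
    (hf : StephenMap R f) (hC : C.Accessible) : D.Accessible := by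
  induction hf with
  | expansion C q₁ q₂ u v _ _ =>
    rintro ⟨q | q⟩
    · exact (hC q).imp fun w hw => (C.toAddPath q₁ q₂ u.toList).path hw
    · obtain ⟨w, hw⟩ := hC q₁
      obtain ⟨w₁, -, -, h, -⟩ := path_addPath C q₁ q₂ u.toList q
      exact ⟨w ++ w₁, (path_append _).2 ⟨_, (C.toAddPath q₁ q₂ u.toList).path hw, h⟩⟩
  | folding => exact hC.quot _
  | iso i =>
    intro q
    obtain ⟨w, hw⟩ := hC (i.symm.toHom.toFun q)
    have := i.toHom.path hw
    rw [i.toHom.map_init] at this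
    exact ⟨w, by simpa [Iso.toHom, Iso.symm] using this⟩
  | comp _ _ ih₁ ih₂ => exact ih₂ (ih₁ hC)

/-- A morphism to a closed inverse automaton extends along the morphisms of Stephen's system. -/
theorem StephenMap.exists_extension {C D : Automaton.{u, v} (Letter A)} {f : Hom C D}
    (hf : StephenMap R f) {Z : Automaton.{u, v} (Letter A)} (hd : Z.Deterministic)
    (hi : Z.Involutive) (hc : Z.ExpansionClosed R) (g : Hom C Z) :
    ∃ h : Hom D Z, f.comp h = g := by
  induction hf with
  | expansion C q₁ q₂ u v huv hp =>
    obtain ⟨s, hs₀, hs₁, hs⟩ := (hc huv (g.path hp)).exists_seq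
    refine ⟨addPathDesc g (fun i => s i.val) ?_ hs₀.symm hs₁.symm, rfl⟩
    rintro p x q (⟨h, h'⟩ | ⟨h, h'⟩)
    · rw [h]
      exact hs _ _ h'
    -- A backward edge of the linear automaton is the inverse of a forward edge labelled `x.inv`.
    · rw [h, ← x.inv_inv]
      exact hi (hs _ _ h')
  | folding C p q q' x h h' =>
    refine ⟨quotDesc _ g ?_, rfl⟩
    rintro _ _ ⟨rfl, rfl⟩
    exact hd (g.map_edge _ _ _ h) (g.map_edge _ _ _ h')
  | iso i =>
    exact ⟨i.symm.toHom.comp g,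
      Hom.ext_toFun fun s => congrArg g.toFun (i.toEquiv.symm_apply_apply s)⟩
  | comp _ _ ih₁ ih₂ =>
    obtain ⟨h, rfl⟩ := ih₁ g
    obtain ⟨h', rfl⟩ := ih₂ h
    exact ⟨h', rfl⟩

/-- An expansion is not surjective on states, but its new states are reached by paths from the old
state `q₁`, so determinism of the target fixes their images. -/
theorem StephenMap.extension_unique {C D : Automaton.{u, v} (Letter A)} {f : Hom C D}
    (hf : StephenMap R f) {Z : Automaton.{u, v} (Letter A)} (hd : Z.Deterministic)
    {h h' : Hom D Z} (e : f.comp h = f.comp h') : h = h' := by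
  induction hf with
  | expansion C q₁ q₂ u v huv hp =>
    refine Hom.ext_toFun ?_
    have e' := Hom.congr_toFun e
    rintro ⟨p | i⟩
    · exact e' p
    · obtain ⟨w₁, -, -, hw, -⟩ := path_addPath C q₁ q₂ u.toList i
      have h₁ := h.path hw
      rw [show h.toFun (Quot.mk _ (Sum.inl q₁)) = h'.toFun (Quot.mk _ (Sum.inl q₁)) from e' q₁]
        at h₁
      exact hd.path_unique h₁ (h'.path hw)
  | folding C p q q' x _ _ =>
    refine Hom.ext_toFun ?_
    rintro ⟨p⟩
    exact Hom.congr_toFun e p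
  | iso i =>
    refine Hom.ext_toFun fun s => ?_
    have := Hom.congr_toFun e (i.toEquiv.symm s)
    simpa [Hom.comp, Iso.toHom] using this
  | comp _ _ ih₁ ih₂ => exact ih₂ (ih₁ e)

/-! ### The closure as a colimit -/

variable {B : Automaton.{u, v} (Letter A)}

/-- The object obtained from `O` by a further morphism of Stephen's system. -/
def StephenObj.extend (O : StephenObj R B) {D : Automaton.{u, v} (Letter A)} (f : Hom O.aut D)
    (hf : StephenMap R f) : StephenObj R B :=
  ⟨D, O.map.comp f, O.isMap.comp hf⟩

/-- The canonical morphism from an object of the directed system to the closure. -/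
def StephenObj.toClosure (O : StephenObj R B) : Hom O.aut (closure R B) where
  toFun s := Quot.mk _ ⟨O, s⟩
  map_init := by
    rw [← O.map.map_init]
    exact (Quot.sound (ColimRel.step (StephenObj.base R B) O O.map O.isMap rfl B.init)).symm
  map_term := by
    rw [← O.map.map_term]
    exact (Quot.sound (ColimRel.step (StephenObj.base R B) O O.map O.isMap rfl B.term)).symm
  map_edge p _ q h := ⟨O, p, q, rfl, rfl, h⟩

theorem StephenObj.toClosure_extend (O : StephenObj R B) {D : Automaton.{u, v} (Letter A)}
    (f : Hom O.aut D) (hf : StephenMap R f) (s : O.aut.State) :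
    (O.extend f hf).toClosure.toFun (f.toFun s) = O.toClosure.toFun s :=
  (Quot.sound (ColimRel.step O (O.extend f hf) f hf rfl s)).symm

theorem closure_exists_rep (S : (closure R B).State) :
    ∃ (O : StephenObj R B) (s : O.aut.State), O.toClosure.toFun s = S := by
  obtain ⟨⟨O, s⟩⟩ := S
  exact ⟨O, s, rfl⟩

/-- States of two objects that are identified in the closure are identified after suitable morphisms
of the system. -/
theorem StephenObj.exists_of_eq {O P : StephenObj R B} {s : O.aut.State} {t : P.aut.State}
    (h : O.toClosure.toFun s = P.toClosure.toFun t) :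
    ∃ (D : Automaton.{u, v} (Letter A)) (f : Hom O.aut D) (g : Hom P.aut D),
      StephenMap R f ∧ StephenMap R g ∧ O.map.comp f = P.map.comp g ∧ f.toFun s = g.toFun t := by
  have key : ∀ x y : (Σ O : StephenObj R B, O.aut.State), Relation.EqvGen (ColimRel R B) x y →
      ∃ (D : Automaton.{u, v} (Letter A)) (f : Hom x.1.aut D) (g : Hom y.1.aut D),
        StephenMap R f ∧ StephenMap R g ∧ x.1.map.comp f = y.1.map.comp g ∧
          f.toFun x.2 = g.toFun y.2 := by
    intro x y hxy
    have hid : ∀ C : Automaton.{u, v} (Letter A), StephenMap R (Hom.id C) := fun C =>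
      StephenMap.iso ⟨Equiv.refl _, rfl, rfl, fun _ _ _ => Iff.rfl⟩
    induction hxy with
    | rel x y h =>
      obtain ⟨O, P, h, hh, comm, s⟩ := h
      exact ⟨P.aut, h, Hom.id _, hh, hid _, comm, rfl⟩
    | refl x => exact ⟨x.1.aut, Hom.id _, Hom.id _, hid _, hid _, rfl, rfl⟩
    | symm x y _ ih =>
      obtain ⟨D, f, g, hf, hg, e, e'⟩ := ih
      exact ⟨D, g, f, hg, hf, e.symm, e'.symm⟩
    | trans x y z _ _ ih₁ ih₂ =>
      obtain ⟨D, f, g, hf, hg, e₁, e₁'⟩ := ih₁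
      obtain ⟨E, f', g', hf', hg', e₂, e₂'⟩ := ih₂
      -- Both cospans have a leg out of the middle object; completing these two legs to a square
      -- joins the cospans.
      obtain ⟨F, h, k, hh, hk, e⟩ := hg.ore hf'
      refine ⟨F, f.comp h, g'.comp k, hf.comp hh, hg'.comp hk, ?_, ?_⟩
      · change (x.1.map.comp f).comp h = (z.1.map.comp g').comp k
        rw [e₁, ← e₂]
        exact congrArg y.1.map.comp e
      · change h.toFun (f.toFun x.2) = k.toFun (g'.toFun z.2)
        rw [e₁', ← e₂']
        exact Hom.congr_toFun e y.2
  exact key ⟨O, s⟩ ⟨P, t⟩ (Quot.eqvGen_exact h)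

/-- States of two objects that are identified in the closure are identified in some object. -/
theorem StephenObj.exists_common {O P : StephenObj R B} {s : O.aut.State} {t : P.aut.State}
    (h : O.toClosure.toFun s = P.toClosure.toFun t) :
    ∃ (Q : StephenObj R B) (f : Hom O.aut Q.aut) (g : Hom P.aut Q.aut),
      f.toFun s = g.toFun t ∧ (∀ r, Q.toClosure.toFun (f.toFun r) = O.toClosure.toFun r) ∧
        ∀ r, Q.toClosure.toFun (g.toFun r) = P.toClosure.toFun r := by
  obtain ⟨D, f, g, hf, hg, e, e'⟩ := StephenObj.exists_of_eq h
  exact ⟨O.extend f hf, f, g, e', O.toClosure_extend f hf, fun r =>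
    (Quot.sound (ColimRel.step P (O.extend f hf) g hg e.symm r)).symm⟩

theorem closure_exists_edge {S T : (closure R B).State} {x : Letter A}
    (h : (closure R B).edge S x T) :
    ∃ (O : StephenObj R B) (s t : O.aut.State),
      O.toClosure.toFun s = S ∧ O.toClosure.toFun t = T ∧ O.aut.edge s x t := h

/-- A path uses finitely many edges, and directedness moves them into a single object one at a time.
-/
theorem closure_exists_path {S T : (closure R B).State} {w : List (Letter A)}
    (h : (closure R B).Path S w T) :
    ∃ (O : StephenObj R B) (s t : O.aut.State),
      O.toClosure.toFun s = S ∧ O.toClosure.toFun t = T ∧ O.aut.Path s w t := by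
  induction w generalizing S with
  | nil =>
    obtain ⟨O, s, hs⟩ := closure_exists_rep S
    exact ⟨O, s, s, hs, hs.trans h, rfl⟩
  | cons x w ih =>
    obtain ⟨U, h₁, h₂⟩ := h
    obtain ⟨O, s, r, rfl, hr, e⟩ := closure_exists_edge h₁
    obtain ⟨P, r', t, hr', rfl, p⟩ := ih h₂
    obtain ⟨Q, f, g, e', hf, hg⟩ := StephenObj.exists_common (hr.trans hr'.symm)
    refine ⟨Q, f.toFun s, g.toFun t, hf s, hg t, f.toFun r, f.map_edge _ _ _ e, ?_⟩
    rw [e']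
    exact g.path p

/-- Once both edges start at the same state of one object, folding them is a morphism of the system,
so their ends agree in the colimit. -/
theorem closure_deterministic : (closure R B).Deterministic := by
  intro S x T T' h h'
  obtain ⟨O, s, t, rfl, rfl, e⟩ := closure_exists_edge h
  obtain ⟨P, s', t', hs, rfl, e'⟩ := closure_exists_edge h'
  obtain ⟨Q, f, g, hst, hf, hg⟩ := StephenObj.exists_common hs.symm
  have e₁ := f.map_edge _ _ _ e
  have e₂ := g.map_edge _ _ _ e'
  rw [hst] at e₁
  have hfold : StephenMap R _ := StephenMap.folding Q.aut _ _ _ x e₁ e₂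
  rw [← hf, ← hg, ← Q.toClosure_extend _ hfold, ← Q.toClosure_extend _ hfold]
  exact congrArg _ (Quot.sound ⟨rfl, rfl⟩)

theorem closure_involutive (hB : B.Involutive) : (closure R B).Involutive := by
  intro S x T h
  obtain ⟨O, s, t, rfl, rfl, e⟩ := closure_exists_edge h
  exact O.toClosure.map_edge _ _ _ (O.isMap.involutive hB e)

theorem closure_accessible (hB : B.Accessible) : (closure R B).Accessible := by
  intro S
  obtain ⟨O, s, rfl⟩ := closure_exists_rep S
  obtain ⟨w, hw⟩ := O.isMap.accessible hB s
  have := O.toClosure.path hw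
  rw [O.toClosure.map_init] at this
  exact ⟨w, this⟩

theorem closure_expansionClosed : (closure R B).ExpansionClosed R := by
  intro S T u v huv h
  obtain ⟨O, s, t, rfl, rfl, p⟩ := closure_exists_path h
  have hexp := StephenMap.expansion O.aut s t u v huv p
  -- The choice of position is immaterial: only the concatenation of the two halves, the whole added
  -- path, is used.
  obtain ⟨w₁, w₂, hw, h₁, h₂⟩ := path_addPath O.aut s t u.toList (lin u.toList).init
  have := (O.extend _ hexp).toClosure.path ((path_append _).2 ⟨_, h₁, h₂⟩)
  rw [← hw] at this
  rw [← O.toClosure_extend _ hexp, ← O.toClosure_extend _ hexp]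
  exact this

/-- A morphism to a closed inverse automaton extends to the closure. -/
theorem closure_nonempty_hom {Z : Automaton.{u, v} (Letter A)} (hd : Z.Deterministic)
    (hi : Z.Involutive) (hc : Z.ExpansionClosed R) (g : Hom B Z) :
    Nonempty (Hom (closure R B) Z) := by
  choose φ hφ using fun O : StephenObj R B => O.isMap.exists_extension hd hi hc g
  -- Uniqueness of extensions turns the separately chosen `φ O` into a cocone.
  have hφ' : ∀ (O P : StephenObj R B) (h : Hom O.aut P.aut), O.map.comp h = P.map →
      h.comp (φ P) = φ O := by
    intro O P h comm
    refine O.isMap.extension_unique hd ?_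
    change (O.map.comp h).comp (φ P) = _
    rw [comm, hφ, hφ]
  refine ⟨⟨Quot.lift (fun x => (φ x.1).toFun x.2) ?_, (φ _).map_init, (φ _).map_term, ?_⟩⟩
  · rintro _ _ ⟨O, P, h, _, comm, s⟩
    exact (Hom.congr_toFun (hφ' O P h comm) s).symm
  · rintro _ x _ ⟨O, s, t, rfl, rfl, e⟩
    exact (φ O).map_edge _ _ _ e

end Automaton

end InvPres

namespace InvPres

/-! ### Presented monoids -/

section PresMonoid

variable {A : Type u}

theorem Word.inv_mul (u v : Word A) : (u * v).inv = v.inv * u.inv := by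
  simp [Word.inv, FreeMonoid.toList_mul, FreeMonoid.ofList_append]

theorem Word.inv_of (x : Letter A) : Word.inv (FreeMonoid.of x) = FreeMonoid.of x.inv := rfl

theorem Word.inv_inv (w : Word A) : w.inv.inv = w := by
  induction w using FreeMonoid.inductionOn' with
  | one => rfl
  | of_mul x w ih => rw [Word.inv_mul, Word.inv_mul, ih, Word.inv_of, Word.inv_of, Letter.inv_inv]

theorem cls_mul (R : Set (Word A × Word A)) (u v : Word A) : cls R (u * v) = cls R u * cls R v :=
  rfl

theorem cls_eq_iff {R : Set (Word A × Word A)} {u v : Word A} :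
    cls R u = cls R v ↔ presCon R u v := (presCon R).eq

theorem exists_cls_eq {R : Set (Word A × Word A)} (m : PresMonoid R) : ∃ u, cls R u = m :=
  Quotient.exists_rep m

theorem cls_eq_of_vagnerRel (R : Set (Word A × Word A)) {u v : Word A} (h : VagnerRel A u v) :
    cls R u = cls R v :=
  cls_eq_iff.2 (ConGen.Rel.of _ _ (Or.inl (ConGen.Rel.of _ _ h)))

theorem cls_eq_of_mem {R : Set (Word A × Word A)} {u v : Word A} (h : (u, v) ∈ R) :
    cls R u = cls R v :=
  cls_eq_iff.2 (ConGen.Rel.of _ _ (Or.inr h))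

theorem cls_mul_inv_mul (R : Set (Word A × Word A)) (w : Word A) :
    cls R w * cls R w.inv * cls R w = cls R w :=
  cls_eq_of_vagnerRel R (VagnerRel.regular w)

/-- An element absorbs `x x⁻¹` on the right if it is `𝓡`-related to its product with `x`. -/
theorem mul_cls_mul_inv_eq {R : Set (Word A × Word A)} {m y : PresMonoid R} {x : Word A}
    (h : m = m * cls R x * y) : m * cls R x * cls R x.inv = m := by
  obtain ⟨u, rfl⟩ := exists_cls_eq m
  have hu := cls_mul_inv_mul R u
  have hx := cls_mul_inv_mul R x
  -- The argument rests on commuting the idempotents `u⁻¹u` and `xx⁻¹`.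
  have hc : cls R u.inv * cls R u * (cls R x * cls R x.inv) =
      cls R x * cls R x.inv * (cls R u.inv * cls R u) := by
    have := cls_eq_of_vagnerRel R (VagnerRel.commute u.inv x)
    rwa [Word.inv_inv] at this
  generalize cls R u = U at *
  generalize cls R u.inv = U' at *
  generalize cls R x = X at *
  generalize cls R x.inv = X' at *
  calc U * X * X' = U * U' * U * X * X' := by rw [hu]
    _ = U * (U' * U * (X * X')) := by simp only [mul_assoc]
    _ = U * (X * X') * U' * U := by rw [hc]; simp only [mul_assoc]
    _ = U * (X * X') * U' * (U * X * y) := by rw [← h]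
    _ = U * (X * X' * (U' * U)) * X * y := by simp only [mul_assoc]
    _ = U * U' * U * (X * X' * X) * y := by rw [← hc]; simp only [mul_assoc]
    _ = U := by rw [hu, hx, ← h]

theorem GreenR.symm {M : Type u} [Monoid M] {m n : M} (h : GreenR m n) : GreenR n m := ⟨h.2, h.1⟩

theorem GreenR.trans {M : Type u} [Monoid M] {m n k : M} (h : GreenR m n) (h' : GreenR n k) :
    GreenR m k := by
  obtain ⟨⟨x, rfl⟩, y, hy⟩ := h
  obtain ⟨⟨x', rfl⟩, y', hy'⟩ := h'
  refine ⟨⟨x' * x, mul_assoc _ _ _⟩, y * y', ?_⟩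
  rw [← mul_assoc, ← hy, ← hy']

theorem GreenR.map {M N : Type*} [Monoid M] [Monoid N] (f : M →* N) {m n : M} (h : GreenR m n) :
    GreenR (f m) (f n) := by
  obtain ⟨⟨x, hx⟩, y, hy⟩ := h
  exact ⟨⟨f x, by rw [← map_mul, ← hx]⟩, f y, by rw [← map_mul, ← hy]⟩

end PresMonoid

/-! ### Schützenberger automata as closed inverse automata -/

section Schutzenberger

open Automaton

variable {A : Type u} {R : Set (Word A × Word A)} {w : Word A}

theorem schutzenberger_deterministic : (schutzenberger R w).Deterministic :=
  fun _ _ _ _ h h' => Subtype.ext (Eq.trans h h'.symm)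

/-- Since `p` and `q = p x` are `𝓡`-related, `p = p x y` for some `y`, and then `p x x⁻¹ = p`. -/
theorem schutzenberger_involutive : (schutzenberger R w).Involutive := by
  intro p x q h
  obtain ⟨⟨y, hy⟩, -⟩ := p.2.trans q.2.symm
  change q.val = _ at h
  change p.val = q.val * cls R (Word.inv (FreeMonoid.of x))
  rw [h] at hy ⊢
  exact (mul_cls_mul_inv_eq hy).symm

theorem schutzenberger_path {p q : (schutzenberger R w).State} {u : Word A} :
    (schutzenberger R w).Path p u.toList q ↔ q.val = p.val * cls R u := by
  induction u using FreeMonoid.inductionOn' generalizing p with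
  | one =>
    change p = q ↔ q.val = p.val * 1
    rw [mul_one]
    exact ⟨fun h => congrArg Subtype.val h.symm, fun h => Subtype.ext h.symm⟩
  | of_mul x u ih =>
    change (∃ r, r.val = p.val * cls R (FreeMonoid.of x) ∧
      (schutzenberger R w).Path r u.toList q) ↔ _
    simp only [ih]
    rw [cls_mul, ← mul_assoc]
    constructor
    · rintro ⟨r, hr, h⟩
      rw [h, hr]
    · intro h
      obtain ⟨⟨y, hy⟩, -⟩ := p.2.trans q.2.symm
      -- The path cannot leave the `𝓡`-class midway: continuing by `u` and then `y` leads from `p x`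
      -- back to `p`.
      refine ⟨⟨p.val * cls R (FreeMonoid.of x), GreenR.trans ⟨⟨_, rfl⟩, cls R u * y, ?_⟩ p.2⟩,
        rfl, h⟩
      rwa [← mul_assoc, ← h]

theorem schutzenberger_expansionClosed : (schutzenberger R w).ExpansionClosed R := by
  intro p q u v huv h
  rw [schutzenberger_path] at h ⊢
  rcases huv with huv | huv
  · rwa [cls_eq_of_mem huv]
  · rwa [← cls_eq_of_mem huv]

theorem schutzenberger_init_mul (m : (schutzenberger R w).State) :
    cls R (w * w.inv) * m.val = m.val := by
  obtain ⟨⟨x, hx⟩, -⟩ := m.2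
  rw [hx, ← mul_assoc, cls_mul, cls_mul_inv_mul]

theorem schutzenberger_accessible : (schutzenberger R w).Accessible := by
  intro m
  obtain ⟨u, hu⟩ := exists_cls_eq m.val
  refine ⟨u.toList, schutzenberger_path.2 ?_⟩
  rw [hu]
  exact (schutzenberger_init_mul m).symm

theorem schutzenberger_path_term :
    (schutzenberger R w).Path (schutzenberger R w).init w.toList (schutzenberger R w).term :=
  schutzenberger_path.2 (schutzenberger_init_mul (schutzenberger R w).term).symm

/-- An accessible closed inverse automaton that accepts `w` and has a morphism to the
Schützenberger automaton of `w` is isomorphic to it. -/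
theorem nonempty_iso_schutzenberger {C : Automaton.{u, v} (Letter A)} (hd : C.Deterministic)
    (hi : C.Involutive) (hc : C.ExpansionClosed R) (ha : C.Accessible)
    (hw : C.Path C.init w.toList C.term) (φ : Hom C (schutzenberger R w)) :
    Nonempty (Iso C (schutzenberger R w)) := by
  have hcon : ∀ {u v : Word A}, cls R u = cls R v → ∀ {p q}, C.Path p u.toList q →
      C.Path p v.toList q := fun h _ _ =>
    (presCon_le_actionCon hd hi hc (cls_eq_iff.1 h) _ _).1
  have hloop : C.Path C.init (w * w.inv).toList C.init := (path_mul_inv hd hi).2 ⟨rfl, _, hw⟩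
  have hφ : ∀ {u : Word A} {c}, C.Path C.init u.toList c →
      (φ.toFun c).val = cls R (w * w.inv * u) := by
    intro u c h
    have := φ.path h
    rw [φ.map_init] at this
    exact schutzenberger_path.1 this
  have happ : ∀ {u v : Word A} {p q r}, C.Path p u.toList q → C.Path q v.toList r →
      C.Path p (u * v).toList r := fun h h' => (path_append C).2 ⟨_, h, h'⟩
  -- The loop at the initial state labelled `w w⁻¹` may be prefixed to any path. States with the
  -- same image are then reached by words equal in the monoid, hence coincide.
  have inj : Function.Injective φ.toFun := by
    intro c c' h
    obtain ⟨u, hu⟩ := ha c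
    obtain ⟨u', hu'⟩ := ha c'
    have h := congrArg Subtype.val h
    rw [hφ (u := FreeMonoid.ofList u) hu, hφ (u := FreeMonoid.ofList u') hu'] at h
    exact hd.path_unique (hcon h (happ hloop hu)) (happ hloop hu')
  have surj : Function.Surjective φ.toFun := by
    intro m
    obtain ⟨y, hy⟩ := exists_cls_eq m.val
    -- As `w = y z` in the monoid, `y z` also labels a path from the initial to the terminal state
    -- of `C`; the state reached after `y` is a preimage of `m`.
    obtain ⟨z, hz⟩ := m.2.2
    obtain ⟨z, rfl⟩ := exists_cls_eq z
    rw [← hy, ← cls_mul] at hz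
    obtain ⟨c, hc, -⟩ := (path_append C).1 (hcon hz hw)
    refine ⟨c, Subtype.ext ?_⟩
    rw [hφ hc, cls_mul, hy, schutzenberger_init_mul]
  refine ⟨⟨Equiv.ofBijective _ ⟨inj, surj⟩, φ.map_init, φ.map_term, fun p x q =>
    ⟨φ.map_edge p x q, fun h => ?_⟩⟩⟩
  obtain ⟨u, hu⟩ := ha p
  obtain ⟨u', hu'⟩ := ha q
  change (φ.toFun q).val = (φ.toFun p).val * _ at h
  rw [hφ (u := FreeMonoid.ofList u) hu, hφ (u := FreeMonoid.ofList u') hu', ← cls_mul] at h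
  -- The path to `q` can be relabelled `w w⁻¹ u x`; by determinism its last edge starts at `p`.
  obtain ⟨r, h₁, h₂⟩ := (path_append C).1 (hcon h (happ hloop hu'))
  obtain rfl := hd.path_unique h₁ (happ hloop hu)
  exact (path_singleton C).1 h₂

end Schutzenberger

/-! ### Contraction -/

section Contraction

variable {A : Type u} (a : A)

theorem erase_of_eq (b : Bool) : erase a (FreeMonoid.of (a, b)) = 1 := by
  simp [erase]

theorem erase_of_ne {x : Letter A} (h : x.1 ≠ a) :
    erase a (FreeMonoid.of x) = FreeMonoid.of (⟨x.1, h⟩, x.2) := by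
  simp [erase, h]

theorem erase_inv (w : Word A) : erase a w.inv = (erase a w).inv := by
  induction w using FreeMonoid.inductionOn' with
  | one => simp [Word.inv]
  | of_mul x w ih =>
    rw [Word.inv_mul, map_mul, map_mul, Word.inv_mul, ih, Word.inv_of]
    congr 1
    by_cases h : x.1 = a
    · obtain ⟨b, s⟩ := x
      obtain rfl : b = a := h
      rw [erase_of_eq]
      exact erase_of_eq _ _
    · rw [erase_of_ne a h, Word.inv_of]
      exact erase_of_ne a (x := x.inv) h

/-- The homomorphism of presented monoids induced by erasing a letter. -/
noncomputable def eraseHom (R : Set (Word A × Word A)) :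
    PresMonoid R →* PresMonoid (eraseRel a R) :=
  (presCon R).lift ((presCon (eraseRel a R)).mk'.comp (erase a)) <| by
    refine Con.conGen_le.2 ?_
    rintro u v (h | h)
    · refine (Con.conGen_le (c := Con.ker _)).2 ?_ h
      rintro _ _ (w | ⟨u, v⟩)
      · change cls _ (erase a _) = cls _ (erase a _)
        simp only [map_mul, erase_inv]
        exact cls_eq_of_vagnerRel _ (VagnerRel.regular _)
      · change cls _ (erase a _) = cls _ (erase a _)
        simp only [map_mul, erase_inv]
        exact cls_eq_of_vagnerRel _ (VagnerRel.commute _ _)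
    · exact cls_eq_of_mem (R := eraseRel a R) ⟨(u, v), h, rfl⟩

theorem eraseHom_cls (R : Set (Word A × Word A)) (u : Word A) :
    eraseHom a R (cls R u) = cls (eraseRel a R) (erase a u) := rfl

namespace Automaton

variable {a} {B : Automaton.{u, v} (Letter A)}

theorem Involutive.collapse (hB : B.Involutive) : (B.collapse a).Involutive := by
  rintro _ x _ ⟨p, q, rfl, rfl, e⟩
  exact ⟨q, p, rfl, rfl, hB e⟩

theorem Involutive.contract (hB : B.Involutive) : (B.contract a).Involutive :=
  hB.collapse.quot _

/-- The projection of the states of `B` to those of the `a`-contracted automaton. -/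
def contractMk (a : A) (B : Automaton.{u, v} (Letter A)) (p : B.State) : (B.contract a).State :=
  ((B.collapse a).toQuot _).toFun (Quot.mk _ p)

theorem Involutive.path_contract (hB : B.Involutive) {p q : B.State} {w : Word A}
    (h : B.Path p w.toList q) :
    (B.contract a).Path (contractMk a B p) (erase a w).toList (contractMk a B q) := by
  induction w using FreeMonoid.inductionOn' generalizing p with
  | one => exact congrArg _ (h : p = q)
  | of_mul x w ih =>
    obtain ⟨r, h₁, h₂⟩ := (h : ∃ r, B.edge p x r ∧ B.Path r w.toList q)
    have ih := ih h₂
    rw [map_mul]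
    by_cases hx : x.1 = a
    · obtain ⟨b, s⟩ := x
      obtain rfl : b = a := hx
      rw [erase_of_eq, one_mul]
      have : contractMk b B p = contractMk b B r := by
        refine congrArg ((B.collapse b).toQuot _).toFun ?_
        cases s with
        | true => exact Quot.sound h₁
        -- `collapse` glues only along edges labelled `a`, so an edge labelled `a⁻¹` is reversed
        -- first.
        | false => exact (Quot.sound (hB h₁)).symm
      rwa [this]
    · rw [erase_of_ne a hx]
      exact ⟨contractMk a B r, ((B.collapse a).toQuot _).map_edge _ _ _ ⟨p, r, rfl, rfl, h₁⟩, ih⟩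

theorem Accessible.contract (hB : B.Accessible) (hi : B.Involutive) :
    (B.contract a).Accessible := by
  rintro ⟨⟨q⟩⟩
  obtain ⟨w, hw⟩ := hB q
  exact ⟨_, hi.path_contract (w := FreeMonoid.ofList w) hw⟩

/-- A map on states that forgets the transitions labelled by `a` and preserves the others induces
a morphism from the `a`-contracted automaton to any deterministic automaton. -/
theorem contract_nonempty_hom {Z : Automaton.{u, v'} (Letter {b : A // b ≠ a})}
    (hd : Z.Deterministic) (f : B.State → Z.State) (hinit : f B.init = Z.init)
    (hterm : f B.term = Z.term) (hf : ∀ p q, B.edge p (a, true) q → f p = f q)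
    (hf' : ∀ p (x : Letter {b : A // b ≠ a}) q, B.edge p (x.1.val, x.2) q → Z.edge (f p) x (f q)) :
    Nonempty (Hom (B.contract a) Z) := by
  let g : Hom (B.collapse a) Z :=
    { toFun := Quot.lift f hf
      map_init := hinit
      map_term := hterm
      map_edge := by
        rintro _ x _ ⟨p, q, rfl, rfl, e⟩
        exact hf' p x q e }
  exact ⟨quotDesc _ g fun _ _ h => h.map_eq hd g⟩

end Automaton

open Automaton

/-- `eraseHom` preserves `𝓡`-classes as any monoid homomorphism does, and it sends `a` to `1`, so
the ends of an edge labelled `a` have equal images. -/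
theorem contract_schutzenberger_nonempty_hom (R : Set (Word A × Word A)) (w : Word A) :
    Nonempty (Hom (contract a (schutzenberger R w))
      (schutzenberger (eraseRel a R) (erase a w))) := by
  refine contract_nonempty_hom schutzenberger_deterministic
    (fun m => ⟨eraseHom a R m.val, m.2.map _⟩) (Subtype.ext ?_) rfl ?_ ?_
  · change cls _ (erase a _) = cls _ _
    rw [map_mul, erase_inv]
  · intro p q h
    change q.val = _ at h
    refine Subtype.ext ?_
    change _ = eraseHom a R q.val
    rw [h, map_mul, eraseHom_cls, erase_of_eq]
    exact (mul_one _).symm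
  · intro p x q h
    change q.val = _ at h
    change eraseHom a R q.val = _
    rw [h, map_mul, eraseHom_cls, erase_of_ne a x.1.2]

end Contraction

end InvPres

/-! ### Contraction and closure of Schützenberger automata -/

theorem proposition4p12 {A : Type u} (R : Set (InvPres.Word A × InvPres.Word A)) (a : A)
    (w : InvPres.Word A) :
    Nonempty (InvPres.Automaton.Iso
      (InvPres.schutzenberger (InvPres.eraseRel a R) (InvPres.erase a w))
      (InvPres.Automaton.closure (InvPres.eraseRel a R)
        (InvPres.Automaton.contract a (InvPres.schutzenberger R w)))) := by
  open InvPres Automaton in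
  have hi : (schutzenberger R w).Involutive := schutzenberger_involutive
  obtain ⟨g⟩ := contract_schutzenberger_nonempty_hom a R w
  obtain ⟨φ⟩ := closure_nonempty_hom schutzenberger_deterministic schutzenberger_involutive
    schutzenberger_expansionClosed g
  -- The path labelled `w` in `𝒜(w)` projects to one labelled by the erased word in the contraction,
  -- which is the base object of the system.
  have hw := (StephenObj.base (eraseRel a R) _).toClosure.path
    (hi.path_contract (a := a) schutzenberger_path_term)
  obtain ⟨e⟩ := nonempty_iso_schutzenberger closure_deterministic
    (closure_involutive hi.contract) closure_expansionClosed
    (closure_accessible (schutzenberger_accessible.contract hi)) hw φ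
  exact ⟨e.symm⟩
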